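/- Consider a sequential team in Witsenhausen's intrinsic model with $N$ decision makers: $(\Omega,\mathcal F)$ is a measurable space with a probability measure $\mu$; $\omega_0=\omega_0(\omega)$ is a measurable function of $\omega\in\Omega$ with values in $\Omega_0$; decision maker $n$ measures $y^n=\eta^n(\omega,u^1,\dots,u^{n-1})\in\mathbb Y^n$, where $\eta^n$ is measurable, and then chooses an action $u^n\in\mathbb U^n$. Here $\Omega_0$, $\mathbb Y^n$ and $\mathbb U^n$ $(1\le n\le N)$ are standard Borel spaces, that is, Borel subsets of Polish spaces, with the subspace topologies. The team may be static (no $\eta^n$ depends on the actions) or dynamic. Let $\mathcal P$ be the space of probability measures on $\Omega_0\times\prod_{n=1}^N(\mathbb Y^n\times\mathbb U^n)$ with the topology of weak convergence. Let $L_R(\mu)\subset\mathcal P$ be the set of all laws of $(\omega_0,y^1,u^1,\dots,y^N,u^N)$ that are induced, with $\omega\sim\mu$, by independently randomized team policies: there are stochastic kernels $\Pi^n$ from $\mathbb Y^n$ to $\mathbb U^n$ such that, for each $n$, the conditional law of $u^n$ given $(\omega,u^1,\dots,u^{n-1})$ is $\Pi^n(\,\cdot\mid y^n)$. Let $L_A(\mu)\subset\mathcal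 P$ be the set of all such laws induced by deterministic team policies $u^n=\gamma^n(y^n)$, with $\gamma^n:\mathbb Y^n\to\mathbb U^n$ measurable. Let $L^{classical}(\mu)\subset\mathcal P$ be the set of all such laws induced by deterministic policies $u^n=\gamma^n(y^1,\dots,y^n)$, with $\gamma^n:\prod_{k\le n}\mathbb Y^k\to\mathbb U^n$ measurable, for the enlarged, classical information structure in which decision maker $n$ knows $y^1,\dots,y^n$. Then: (i) $L_R(\mu)$ is a Borel subset of $\mathcal P$. (ii) $L_A(\mu)$ is a Borel subset of $\mathcal P$. Moreover, $L^{classical}(\mu)$ is a Borel subset of $\mathcal P$ and $L_A(\mu)=L_R(\mu)\cap L^{classical}(\mu)$. -/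

import Mathlib

open MeasureTheory ProbabilityTheory

/-- The actions `u^k`, `k < n`, of the decision makers that act before decision maker `n`. -/
abbrev PastActions {N : ℕ} (U : Fin N → Type*) (n : Fin N) : Type _ := ∀ k : Set.Iio n, U k

/-- The actions taken before stage `n`, extracted from the list of all actions. -/
def pastActions {N : ℕ} {U : Fin N → Type*} (n : Fin N) (u : ∀ k, U k) : PastActions U n :=
  fun k => u k

/-- Witsenhausen's intrinsic model of a sequential team with `N` decision makers: `Ω` carries all
the exogenous uncertainty, `ω₀` is the part of it that is relevant for the cost, and decision maker
`n` measures `y^n = η^n (ω, u^1, …, u^(n-1))` before choosing the action `u^n`.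
The team is static when the `η n` do not depend on the actions. -/
structure SequentialTeam {N : ℕ} (Ω Ω₀ : Type*) (Y U : Fin N → Type*)
    [MeasurableSpace Ω] [MeasurableSpace Ω₀]
    [∀ n, MeasurableSpace (Y n)] [∀ n, MeasurableSpace (U n)] where
  /-- the cost-relevant exogenous variable -/
  ω₀ : Ω → Ω₀
  measurable_ω₀ : Measurable ω₀
  /-- the measurement functions -/
  η : ∀ n, Ω × PastActions U n → Y n
  measurable_η : ∀ n, Measurable (η n)

/-- The actions that a deterministic policy produces in closed loop: if decision maker `n` has the
information `ι n (ω, u^1, …, u^(n-1))` and applies the control law `γ n` to it, then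
`u^n = γ^n (ι^n (ω, u^1, …, u^(n-1)))`. -/
def closedLoopActions {N : ℕ} {Ω : Type*} {U I : Fin N → Type*}
    (ι : ∀ n, Ω × PastActions U n → I n) (γ : ∀ n, I n → U n) (ω : Ω) (n : Fin N) : U n :=
  γ n (ι n (ω, fun k : Set.Iio n => closedLoopActions ι γ ω k.1))
termination_by n
decreasing_by exact k.2

theorem measurable_pastActions {N : ℕ} {U : Fin N → Type*} [∀ n, MeasurableSpace (U n)]
    (n : Fin N) : Measurable (pastActions (U := U) n) :=
  measurable_pi_lambda _ fun k => measurable_pi_apply k.1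

theorem measurable_closedLoopActions {N : ℕ} {Ω : Type*} {U I : Fin N → Type*}
    [MeasurableSpace Ω] [∀ n, MeasurableSpace (U n)] [∀ n, MeasurableSpace (I n)]
    {ι : ∀ n, Ω × PastActions U n → I n} (hι : ∀ n, Measurable (ι n))
    {γ : ∀ n, I n → U n} (hγ : ∀ n, Measurable (γ n)) :
    Measurable (closedLoopActions ι γ) := by
  refine measurable_pi_lambda _ fun n => ?_
  induction n using WellFoundedLT.induction with
  | ind n ih =>
    have h : (fun ω => closedLoopActions ι γ ω n) =
        fun ω => γ n (ι n (ω, fun k : Set.Iio n => closedLoopActions ι γ ω k.1)) := by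
      funext ω
      rw [closedLoopActions]
    rw [h]
    exact (hγ n).comp ((hι n).comp
      (measurable_id.prodMk (measurable_pi_lambda _ fun k => ih k.1 k.2)))

namespace SequentialTeam

variable {N : ℕ} {Ω Ω₀ : Type*} {Y U : Fin N → Type*}
  [MeasurableSpace Ω] [MeasurableSpace Ω₀]
  [∀ n, MeasurableSpace (Y n)] [∀ n, MeasurableSpace (U n)]

/-- The realization `(ω₀, (y^1, u^1), …, (y^N, u^N))` that belongs to `ω` and to the actions
`u^1, …, u^N`. -/
def outcome (T : SequentialTeam Ω Ω₀ Y U) (x : Ω × (∀ n, U n)) : Ω₀ × (∀ n, Y n × U n) :=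
  (T.ω₀ x.1, fun n => (T.η n (x.1, pastActions n x.2), x.2 n))

theorem measurable_outcome (T : SequentialTeam Ω Ω₀ Y U) : Measurable T.outcome := by
  refine (T.measurable_ω₀.comp measurable_fst).prodMk (measurable_pi_lambda _ fun n => ?_)
  exact ((T.measurable_η n).comp
    (measurable_fst.prodMk ((measurable_pastActions n).comp measurable_snd))).prodMk
    ((measurable_pi_apply n).comp measurable_snd)

/-- The enlarged, classical information structure: decision maker `n` knows `(y^1, …, y^n)`. -/
def classicalInfo (T : SequentialTeam Ω Ω₀ Y U) (n : Fin N) (x : Ω × PastActions U n) :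
    ∀ j : Set.Iic n, Y j :=
  fun j => T.η j (x.1, fun k : Set.Iio j.1 =>
    x.2 ⟨k.1, Set.mem_Iio.mpr (lt_of_lt_of_le (Set.mem_Iio.mp k.2) (Set.mem_Iic.mp j.2))⟩)

theorem measurable_classicalInfo (T : SequentialTeam Ω Ω₀ Y U) (n : Fin N) :
    Measurable (T.classicalInfo n) :=
  measurable_pi_lambda _ fun j => (T.measurable_η j).comp
    (measurable_fst.prodMk (measurable_pi_lambda _ fun k : Set.Iio j.1 =>
      (measurable_pi_apply (⟨k.1, Set.mem_Iio.mpr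
        (lt_of_lt_of_le (Set.mem_Iio.mp k.2) (Set.mem_Iic.mp j.2))⟩ : Set.Iio n)).comp measurable_snd))

/-- `Q` is the joint law of `(ω, u^1, …, u^N)` when `ω` has law `μ` and the decision makers apply
the independently randomized policy `π`: given `ω, u^1, …, u^(n-1)`, the action `u^n` has the
conditional law `π^n (· | y^n)`. -/
structure IsClosedLoopLaw (T : SequentialTeam Ω Ω₀ Y U) (μ : Measure Ω)
    (π : ∀ n, Kernel (Y n) (U n)) (Q : Measure (Ω × (∀ n, U n))) : Prop where
  map_fst : Q.map Prod.fst = μ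
  map_action : ∀ n, Q.map (fun x => ((x.1, pastActions n x.2), x.2 n)) =
    (Q.map fun x => (x.1, pastActions n x.2)) ⊗ₘ (π n).comap (T.η n) (T.measurable_η n)

/-- `L_R`: the laws of `(ω₀, (y^1, u^1), …, (y^N, u^N))` under independently randomized team
policies. -/
def randomizedStrategicMeasures (T : SequentialTeam Ω Ω₀ Y U) (μ : Measure Ω) :
    Set (ProbabilityMeasure (Ω₀ × (∀ n, Y n × U n))) :=
  {P | ∃ π : ∀ n, Kernel (Y n) (U n), (∀ n, IsMarkovKernel (π n)) ∧
    ∃ Q : Measure (Ω × (∀ n, U n)), T.IsClosedLoopLaw μ π Q ∧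
      (P : Measure (Ω₀ × (∀ n, Y n × U n))) = Q.map T.outcome}

/-- `L_A`: the laws of `(ω₀, (y^1, u^1), …, (y^N, u^N))` under deterministic team policies
`u^n = γ^n (y^n)`. -/
def deterministicStrategicMeasures (T : SequentialTeam Ω Ω₀ Y U) (μ : Measure Ω) :
    Set (ProbabilityMeasure (Ω₀ × (∀ n, Y n × U n))) :=
  {P | ∃ γ : ∀ n, Y n → U n, (∀ n, Measurable (γ n)) ∧
    (P : Measure (Ω₀ × (∀ n, Y n × U n))) =
      μ.map fun ω => T.outcome (ω, closedLoopActions T.η γ ω)}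

/-- `L^classical`: the laws of `(ω₀, (y^1, u^1), …, (y^N, u^N))` under deterministic policies
`u^n = γ^n (y^1, …, y^n)` for the enlarged, classical information structure. -/
def classicalStrategicMeasures (T : SequentialTeam Ω Ω₀ Y U) (μ : Measure Ω) :
    Set (ProbabilityMeasure (Ω₀ × (∀ n, Y n × U n))) :=
  {P | ∃ γ : ∀ n, (∀ j : Set.Iic n, Y j) → U n, (∀ n, Measurable (γ n)) ∧
    (P : Measure (Ω₀ × (∀ n, Y n × U n))) =
      μ.map fun ω => T.outcome (ω, closedLoopActions T.classicalInfo γ ω)}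

end SequentialTeam

/-! The law `P` of the outcome already contains the policy that produced it. For each decision maker
it determines the joint law of information and action, and by almost sure uniqueness of
disintegrations any randomized policy inducing `P` agrees almost surely with the conditional law of
the action given the information under `P`. This conditional law can be chosen jointly measurable in
`P` and the information (`condKernel` of `readKernel`).

Hence `P` is a randomized strategic measure iff it is reproduced by the closed loop built from its
own conditional kernels. That closed loop is a kernel in `P` (`exists_kernel_isLawUnder`), a policy
has only one closed-loop law (`IsLawUnder.unique`), and two kernels agree on a measurable set
(`measurableSet_kernel_eq`). Deterministic policies add the requirement that these conditional
kernels be almost surely Dirac, a measurable condition since it says that the square of the kernel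
is carried by the diagonal. The classical case is the same argument with a larger information map.

For the intersection: under a classical deterministic policy the action is a function of the
history. If its conditional law given the history is also `π n` at the measurement, that law is
almost surely Dirac, so `π n` may be replaced by a measurable function of the measurement. -/

/-! ### Measurability of spaces of measures, and Dirac-valued kernels. -/

section Measures

/-- A composition-product with a kernel that only depends on `f a` pushes forward along `f`. -/
theorem map_compProd_comap {A B C : Type*} [MeasurableSpace A] [MeasurableSpace B]
    [MeasurableSpace C] (ν : Measure A) [SFinite ν] {f : A → B} (hf : Measurable f)
    (κ : Kernel B C) [IsSFiniteKernel κ] :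
    (ν ⊗ₘ κ.comap f hf).map (Prod.map f id) = ν.map f ⊗ₘ κ := by
  ext s hs
  have hm : Measurable (Prod.map f (id : C → C)) := hf.prodMap measurable_id
  rw [Measure.map_apply hm hs, Measure.compProd_apply (hm hs), Measure.compProd_apply hs,
    lintegral_map (Kernel.measurable_kernel_prodMk_left hs) hf]
  rfl

/-- Two measurable families of probability measures agree on a measurable set of parameters. -/
theorem measurableSet_kernel_eq {A Z : Type*} [MeasurableSpace A] [MeasurableSpace Z]
    [MeasurableSpace.CountablyGenerated Z] (κ κ' : Kernel A Z) [IsMarkovKernel κ]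
    [IsMarkovKernel κ'] : MeasurableSet {a | κ a = κ' a} := by
  obtain ⟨b, hb, hgen⟩ := MeasurableSpace.CountablyGenerated.isCountablyGenerated (α := Z)
  -- The generated algebra is still countable and is a π-system, so equality on it decides equality
  -- of probability measures.
  have hc := countable_generateSetAlgebra hb
  have hg : ‹MeasurableSpace Z› = MeasurableSpace.generateFrom (generateSetAlgebra b) := by
    rw [generateFrom_generateSetAlgebra_eq, hgen]
  have hm : ∀ s ∈ generateSetAlgebra b, MeasurableSet s := fun s hs => by
    rw [hg]; exact MeasurableSpace.measurableSet_generateFrom hs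
  have h : {a | κ a = κ' a} = ⋂ s ∈ generateSetAlgebra b, {a | κ a s = κ' a s} := by
    ext a
    simp only [Set.mem_ofPred_eq, Set.mem_iInter]
    refine ⟨fun h s _ => by rw [h], fun h => ?_⟩
    exact ext_of_generate_finite _ hg isSetAlgebra_generateSetAlgebra.isSetRing.isSetSemiring.isPiSystem
      h (by simp)
  rw [h]
  exact MeasurableSet.biInter hc fun s hs => measurableSet_eq_fun
    (Kernel.measurable_coe κ (hm s hs)) (Kernel.measurable_coe κ' (hm s hs))

/-- Sets that are measurable for the evaluations are Borel for the topology of weak convergence. -/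
theorem measurableSpace_probabilityMeasure_le_borel {Z : Type*} [TopologicalSpace Z]
    [MeasurableSpace Z] [BorelSpace Z] [HasOuterApproxClosed Z] :
    (inferInstance : MeasurableSpace (ProbabilityMeasure Z)) ≤ borel (ProbabilityMeasure Z) := by
  let mB : MeasurableSpace (ProbabilityMeasure Z) := borel (ProbabilityMeasure Z)
  have : BorelSpace (ProbabilityMeasure Z) := ⟨rfl⟩
  -- The mass of a closed set is a limit of integrals of bounded continuous functions, each weakly
  -- continuous in the measure.
  have key : Measurable (fun P : ProbabilityMeasure Z => (P : Measure Z)) := by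
    refine Measurable.measure_of_isPiSystem_of_isProbabilityMeasure
      (S := {F : Set Z | IsClosed F}) ?_ isPiSystem_isClosed ?_
    · rw [BorelSpace.measurable_eq (α := Z), borel_eq_generateFrom_isClosed]
    · intro F hF
      refine measurable_of_tendsto_metrizable (f := fun (n : ℕ) (P : ProbabilityMeasure Z) =>
        ∫⁻ z, (hF.apprSeq n z : ENNReal) ∂(P : Measure Z)) (fun n => ?_) ?_
      · exact (ProbabilityMeasure.continuous_lintegral_boundedContinuousFunction
          (hF.apprSeq n)).measurable
      · rw [tendsto_pi_nhds]
        intro P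
        exact HasOuterApproxClosed.tendsto_lintegral_apprSeq hF (P : Measure Z)
  exact MeasurableSpace.comap_le_iff_le_map.mpr key

/-- The tautological kernel from probability measures to points. -/
noncomputable def evaluationKernel (Z : Type*) [MeasurableSpace Z] :
    Kernel (ProbabilityMeasure Z) Z where
  toFun P := P
  measurable' := measurable_subtype_coe

@[simp] theorem evaluationKernel_apply {Z : Type*} [MeasurableSpace Z] (P : ProbabilityMeasure Z) :
    evaluationKernel Z P = (P : Measure Z) := rfl

instance (Z : Type*) [MeasurableSpace Z] : IsMarkovKernel (evaluationKernel Z) :=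
  ⟨fun P => by rw [evaluationKernel_apply]; infer_instance⟩

theorem eq_dirac_of_ae_eq {X : Type*} [MeasurableSpace X] {m : Measure X} [IsProbabilityMeasure m]
    {x : X} (h : ∀ᵐ y ∂m, y = x) : m = Measure.dirac x := by
  have := Measure.map_congr (mβ := ‹MeasurableSpace X›) (f := id) (g := fun _ => x) h
  rw [Measure.map_id, Measure.map_const] at this
  simpa using this

/-- A probability measure whose square is carried by the diagonal is a Dirac mass. -/
theorem exists_eq_dirac_iff {X : Type*} [MeasurableSpace X] [StandardBorelSpace X]
    (m : Measure X) [IsProbabilityMeasure m] :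
    (∃ x, m = Measure.dirac x) ↔ (m.prod m) (Set.diagonal X)ᶜ = 0 := by
  have hd : MeasurableSet (Set.diagonal X)ᶜ := measurableSet_diagonal.compl
  constructor
  · rintro ⟨x, rfl⟩
    rw [Measure.dirac_prod_dirac, Measure.dirac_apply' _ hd]
    simp
  · intro h
    -- By Fubini, almost every `x` satisfies `y = x` for almost every `y`; any one such `x` is the
    -- atom.
    rw [Measure.measure_prod_null hd] at h
    obtain ⟨x, hx⟩ := h.exists
    refine ⟨x, eq_dirac_of_ae_eq ?_⟩
    rw [ae_iff]
    refine measure_mono_null ?_ hx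
    intro y hy
    simpa [eq_comm] using hy

/-- A Markov kernel that is almost surely a Dirac mass is almost surely deterministic. -/
theorem exists_ae_eq_deterministic {I X : Type*} [MeasurableSpace I] [MeasurableSpace X]
    [StandardBorelSpace X] [Nonempty X] (ν : Measure I) (κ : Kernel I X) [IsMarkovKernel κ]
    (h : ∀ᵐ i ∂ν, ∃ x, κ i = Measure.dirac x) :
    ∃ (γ : I → X) (hγ : Measurable γ), κ =ᵐ[ν] Kernel.deterministic γ hγ := by
  have he := measurableEmbedding_embeddingReal X
  obtain ⟨r, hr, hre⟩ := he.exists_measurable_extend (measurable_id (α := X))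
    fun _ => inferInstance
  -- The mean of the real embedding under a Dirac mass is the embedded atom, and `r` decodes it.
  -- Values where `κ i` is not Dirac do not matter.
  have hg : Measurable fun i => ∫ x, embeddingReal X x ∂κ i :=
    (he.measurable.stronglyMeasurable.integral_kernel).measurable
  refine ⟨fun i => r (∫ x, embeddingReal X x ∂κ i), hr.comp hg, ?_⟩
  filter_upwards [h] with i hi
  obtain ⟨x, hx⟩ := hi
  rw [Kernel.deterministic_apply, hx, integral_dirac]
  congr 1
  exact (congrFun hre x).symm

end Measures

/-! ### Existence and uniqueness of closed-loop laws. -/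

section ClosedLoop

variable {N : ℕ} {Ω : Type*} {U I : Fin N → Type*} [MeasurableSpace Ω]
  [∀ n, MeasurableSpace (U n)] [∀ n, MeasurableSpace (I n)]

/-- What happens before decision maker `n` acts. -/
def history (n : Fin N) (x : Ω × (∀ k, U k)) : Ω × PastActions U n :=
  (x.1, pastActions n x.2)

theorem measurable_history (n : Fin N) : Measurable (history (Ω := Ω) (U := U) n) :=
  measurable_fst.prodMk ((measurable_pastActions n).comp measurable_snd)

/-- `Q` is a joint law of `(ω, u^1, …, u^N)` under the randomized policy `π` for the information
`ι`. -/
structure IsLawUnder {ι : ∀ n, Ω × PastActions U n → I n} (hι : ∀ n, Measurable (ι n))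
    (μ : Measure Ω) (π : ∀ n, Kernel (I n) (U n)) (Q : Measure (Ω × (∀ n, U n))) : Prop where
  map_fst : Q.map Prod.fst = μ
  map_action : ∀ n, Q.map (fun x => (history n x, x.2 n)) =
    (Q.map (history n)) ⊗ₘ (π n).comap (ι n) (hι n)

variable {ι : ∀ n, Ω × PastActions U n → I n} {hι : ∀ n, Measurable (ι n)} {μ : Measure Ω}
  {π π' : ∀ n, Kernel (I n) (U n)} {Q Q' : Measure (Ω × (∀ n, U n))}

theorem measurable_history_action (n : Fin N) :
    Measurable fun x : Ω × (∀ k, U k) => (history n x, x.2 n) :=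
  (measurable_history n).prodMk ((measurable_pi_apply n).comp measurable_snd)

namespace IsLawUnder

theorem isProbabilityMeasure [IsProbabilityMeasure μ] (h : IsLawUnder hι μ π Q) :
    IsProbabilityMeasure Q := by
  refine ⟨?_⟩
  have := congrArg (fun m => m Set.univ) h.map_fst
  simpa [Measure.map_apply measurable_fst MeasurableSet.univ] using this

/-- The joint law of the information and the action of decision maker `n`. -/
theorem map_info_action [SFinite Q] [∀ n, IsSFiniteKernel (π n)] (h : IsLawUnder hι μ π Q)
    (n : Fin N) : Q.map (fun x => (ι n (history n x), x.2 n)) =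
      (Q.map fun x => ι n (history n x)) ⊗ₘ π n := by
  have := congrArg (Measure.map (Prod.map (ι n) id)) (h.map_action n)
  rw [map_compProd_comap, Measure.map_map ((hι n).prodMap measurable_id)
    (measurable_history_action n), Measure.map_map (hι n) (measurable_history n)] at this
  exact this

/-- Policies may be changed on null sets of the information. -/
theorem congr [SFinite Q] [∀ n, IsSFiniteKernel (π n)] [∀ n, IsSFiniteKernel (π' n)]
    (h : IsLawUnder hι μ π Q)
    (hπ : ∀ n, π n =ᵐ[Q.map fun x => ι n (history n x)] π' n) : IsLawUnder hι μ π' Q := by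
  refine ⟨h.map_fst, fun n => ?_⟩
  rw [h.map_action n]
  refine Measure.compProd_congr ?_
  have hn := hπ n
  rw [show (fun x : Ω × (∀ k, U k) => ι n (history n x)) = ι n ∘ history n from rfl,
    ← Measure.map_map (hι n) (measurable_history n)] at hn
  filter_upwards [ae_of_ae_map (hι n).aemeasurable hn] with v hv
  simpa [Kernel.comap_apply] using hv

/-- A policy determines the law of the closed loop. -/
theorem unique [SFinite Q] [SFinite Q'] (h : IsLawUnder hι μ π Q) (h' : IsLawUnder hι μ π Q') :
    Q = Q' := by
  rcases isEmpty_or_nonempty (∀ n, U n) with hU | ⟨⟨u₀⟩⟩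
  · rw [Measure.eq_zero_of_isEmpty Q, Measure.eq_zero_of_isEmpty Q']
  -- `F m` keeps the first `m` actions and freezes the others at `u₀`; the truncated laws are
  -- compared by induction on `m`.
  let F : ℕ → Ω × (∀ k, U k) → Ω × (∀ k, U k) := fun m x =>
    (x.1, fun j => if j.val < m then x.2 j else u₀ j)
  have hF : ∀ m, Measurable (F m) := fun m => measurable_fst.prodMk <|
    measurable_pi_lambda _ fun j => by
      by_cases hj : j.val < m
      · simp only [hj, if_true]
        exact (measurable_pi_apply j).comp measurable_snd
      · simp [hj]
  have key : ∀ m ≤ N, Q.map (F m) = Q'.map (F m) := by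
    intro m
    induction m with
    | zero =>
      intro _
      have hc : Measurable fun ω : Ω => (ω, u₀) := measurable_id.prodMk measurable_const
      have : F 0 = (fun ω : Ω => (ω, u₀)) ∘ Prod.fst := by
        funext x; simp [F]
      rw [this, ← Measure.map_map hc measurable_fst, ← Measure.map_map hc measurable_fst,
        h.map_fst, h'.map_fst]
    | succ m ih =>
      intro hm
      let n : Fin N := ⟨m, hm⟩
      have hhist : (history n : Ω × (∀ k, U k) → _) = history n ∘ F m := by
        funext x
        refine Prod.ext rfl (funext fun k => ?_)
        have hk : (k : Fin N).val < m := k.2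
        simp [F, history, pastActions, hk]
      -- `G` rebuilds the next truncation from the history and action of `n`, whose joint law is
      -- fixed by the policy and the previous truncation.
      let G : (Ω × PastActions U n) × U n → Ω × (∀ k, U k) := fun p =>
        (p.1.1, fun j => if hj : j < n then p.1.2 ⟨j, hj⟩ else
          if hj' : j = n then hj' ▸ p.2 else u₀ j)
      have hG : Measurable G := (measurable_fst.comp measurable_fst).prodMk <|
        measurable_pi_lambda _ fun j => by
          by_cases hj : j < n
          · simp only [hj, dif_pos]
            exact (measurable_pi_apply (⟨j, hj⟩ : Set.Iio n)).comp
              (measurable_snd.comp measurable_fst)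
          · by_cases hj' : j = n
            · subst hj'
              simpa using measurable_snd
            · simp [hj, hj']
      have hFG : F (m + 1) = G ∘ fun x => (history n x, x.2 n) := by
        funext x
        refine Prod.ext rfl (funext fun j => ?_)
        rcases lt_trichotomy j n with hj | hj | hj
        · have : j.val < m + 1 := Nat.lt_succ_of_lt hj
          simp [F, G, hj, this, history, pastActions]
        · subst hj
          simp [F, G, n]
        · have h1 : ¬ j.val < m + 1 := not_lt.mpr hj
          simp [F, G, h1, hj.ne', not_lt.mpr hj.le]
      rw [hFG, ← Measure.map_map hG (measurable_history_action n),
        ← Measure.map_map hG (measurable_history_action n), h.map_action n, h'.map_action n,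
        hhist, ← Measure.map_map (measurable_history n) (hF m),
        ← Measure.map_map (measurable_history n) (hF m), ih (Nat.le_of_succ_le hm)]
  have hid : F N = id := by
    funext x
    simp [F]
  simpa [hid] using key N le_rfl

end IsLawUnder

/-- Closed-loop laws exist, and depend measurably on the parameters of the policies. -/
theorem exists_kernel_isLawUnder {A : Type*} [MeasurableSpace A] [∀ n, Nonempty (U n)]
    (hι : ∀ n, Measurable (ι n)) (μ : Measure Ω) [IsProbabilityMeasure μ]
    (π : ∀ n, Kernel (A × I n) (U n)) [∀ n, IsMarkovKernel (π n)] :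
    ∃ K : Kernel A (Ω × (∀ n, U n)), IsMarkovKernel K ∧
      ∀ a, IsLawUnder hι μ (fun n => (π n).sectR a) (K a) := by
  -- After `m` stages only the first `m` actions obey the policy; the others are placeholders,
  -- overwritten in turn.
  have key : ∀ m ≤ N, ∃ K : Kernel A (Ω × (∀ n, U n)), IsMarkovKernel K ∧
      ∀ a, (K a).map Prod.fst = μ ∧ ∀ n : Fin N, n.val < m →
        (K a).map (fun x => (history n x, x.2 n)) =
          ((K a).map (history n)) ⊗ₘ ((π n).sectR a).comap (ι n) (hι n) := by
    intro m
    induction m with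
    | zero =>
      intro _
      let u₀ : ∀ n, U n := fun n => Classical.arbitrary (U n)
      refine ⟨Kernel.const A (μ.prod (Measure.dirac u₀)), inferInstance, fun a => ⟨?_, ?_⟩⟩
      · simp
      · simp
    | succ m ih =>
      intro hm
      obtain ⟨K, hK, hKa⟩ := ih (Nat.le_of_succ_le hm)
      let n : Fin N := ⟨m, hm⟩
      let g : A × (Ω × (∀ k, U k)) → A × I n := fun p => (p.1, ι n (history n p.2))
      have hg : Measurable g := measurable_fst.prodMk
        ((hι n).comp ((measurable_history n).comp measurable_snd))
      let upd : (Ω × (∀ k, U k)) × U n → Ω × (∀ k, U k) :=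
        fun p => (p.1.1, Function.update p.1.2 n p.2)
      have hupd : Measurable upd := (measurable_fst.comp measurable_fst).prodMk <|
        measurable_pi_lambda _ fun j => by
          by_cases hj : j = n
          · subst hj
            simpa using measurable_snd
          · simp only [Function.update_of_ne hj]
            exact (measurable_pi_apply j).comp (measurable_snd.comp measurable_fst)
      -- Overwriting action `n` is invisible to the histories up to `n`, so the conditions already
      -- established survive.
      have hpast : ∀ (k : Fin N), k ≤ n → ∀ p, history k (upd p) = history k p.1 := by
        intro k hk p
        refine Prod.ext rfl (funext fun j => ?_)
        have : (j : Fin N) ≠ n := (lt_of_lt_of_le j.2 hk).ne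
        simp [upd, history, pastActions, this]
      refine ⟨(K ⊗ₖ (π n).comap g hg).map upd, Kernel.IsMarkovKernel.map _ hupd, fun a => ?_⟩
      have hval : ((K ⊗ₖ (π n).comap g hg).map upd) a =
          (K a ⊗ₘ (((π n).sectR a).comap (ι n) (hι n)).comap (history n)
            (measurable_history n)).map upd := by
        rw [Kernel.map_apply _ hupd, Kernel.compProd_apply_eq_compProd_sectR]
        rfl
      rw [hval]
      set κ := (((π n).sectR a).comap (ι n) (hι n)).comap (history n)
            (measurable_history n) with hκ
      have hfst : ∀ {B : Type _} [MeasurableSpace B] (f : Ω × (∀ k, U k) → B), Measurable f →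
          (∀ p, f (upd p) = f p.1) → ((K a ⊗ₘ κ).map upd).map f = (K a).map f := by
        intro B _ f hf h
        rw [Measure.map_map hf hupd, show f ∘ upd = f ∘ Prod.fst from funext h,
          ← Measure.map_map hf measurable_fst]
        change ((K a ⊗ₘ κ).fst).map f = _
        rw [Measure.fst_compProd]
      have hfst' : ((K a ⊗ₘ κ).map upd).map Prod.fst = (K a).map Prod.fst := by
        rw [Measure.map_map measurable_fst hupd, show Prod.fst ∘ upd = Prod.fst ∘ Prod.fst from rfl,
          ← Measure.map_map measurable_fst measurable_fst]
        change ((K a ⊗ₘ κ).fst).map _ = _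
        rw [Measure.fst_compProd]
      refine ⟨hfst'.trans (hKa a).1, fun k hk => ?_⟩
      have hkn : k ≤ n := Nat.le_of_lt_succ hk
      rw [hfst (history k) (measurable_history k) (hpast k hkn)]
      rcases hkn.lt_or_eq with hlt | rfl
      · rw [hfst _ (measurable_history_action k) fun p => ?_]
        · exact (hKa a).2 k hlt
        · rw [hpast k hkn]
          simp [upd, hlt.ne]
      · rw [Measure.map_map (measurable_history_action _) hupd,
          ← map_compProd_comap (K a) (measurable_history _)]
        congr 1
        funext p
        exact Prod.ext (hpast _ le_rfl p) (by simp [upd])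
  obtain ⟨K, hK, h⟩ := key N le_rfl
  exact ⟨K, hK, fun a => ⟨(h a).1, fun n => (h a).2 n n.2⟩⟩

/-- The closed loop of a deterministic policy. -/
theorem isLawUnder_closedLoopActions [IsProbabilityMeasure μ] {γ : ∀ n, I n → U n}
    (hγ : ∀ n, Measurable (γ n)) :
    IsLawUnder hι μ (fun n => Kernel.deterministic (γ n) (hγ n))
      (μ.map fun ω => (ω, closedLoopActions ι γ ω)) := by
  have hm : Measurable fun ω => (ω, closedLoopActions ι γ ω) :=
    measurable_id.prodMk (measurable_closedLoopActions hι hγ)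
  refine ⟨?_, fun n => ?_⟩
  · rw [Measure.map_map measurable_fst hm]
    exact Measure.map_id
  · have : (Kernel.deterministic (γ n) (hγ n)).comap (ι n) (hι n) =
        Kernel.deterministic (γ n ∘ ι n) ((hγ n).comp (hι n)) := by
      ext v
      simp [Kernel.comap_apply, Kernel.deterministic_apply]
    rw [this, Measure.compProd_deterministic, Measure.map_map (measurable_history_action n) hm,
      Measure.map_map (measurable_history n) hm, Measure.map_map _
        ((measurable_history n).comp hm)]
    · congr 1
      funext ω
      refine Prod.ext rfl ?_
      change closedLoopActions ι γ ω n = γ n (ι n (ω, _))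
      rw [closedLoopActions]
      rfl
    · exact measurable_id.prodMk ((hγ n).comp (hι n))

end ClosedLoop

/-! ### Measurability of sets of laws for a general information structure. -/

section StrategicMeasures

variable {N : ℕ} {Ω Z : Type*} {U I : Fin N → Type*} [MeasurableSpace Ω] [MeasurableSpace Z]
  [∀ n, MeasurableSpace (U n)] [∀ n, MeasurableSpace (I n)]
  {ι : ∀ n, Ω × PastActions U n → I n}

/-- The laws of `O (ω, u)` under randomized policies for the information `ι`. -/
def randomizedLaws (hι : ∀ n, Measurable (ι n)) (O : Ω × (∀ n, U n) → Z) (μ : Measure Ω) :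
    Set (ProbabilityMeasure Z) :=
  {P | ∃ π : ∀ n, Kernel (I n) (U n), (∀ n, IsMarkovKernel (π n)) ∧
    ∃ Q, IsLawUnder hι μ π Q ∧ (P : Measure Z) = Q.map O}

/-- The laws of `O (ω, u)` under deterministic policies for the information `ι`. -/
def deterministicLaws (ι : ∀ n, Ω × PastActions U n → I n) (O : Ω × (∀ n, U n) → Z)
    (μ : Measure Ω) : Set (ProbabilityMeasure Z) :=
  {P | ∃ γ : ∀ n, I n → U n, (∀ n, Measurable (γ n)) ∧
    (P : Measure Z) = μ.map fun ω => O (ω, closedLoopActions ι γ ω)}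

variable {hι : ∀ n, Measurable (ι n)} {O : Ω × (∀ n, U n) → Z} {μ : Measure Ω}
  [IsProbabilityMeasure μ]

/-- By uniqueness of the closed-loop law, deterministic policies are exactly the randomized ones
given by deterministic kernels. -/
theorem mem_deterministicLaws_iff (hO : Measurable O) {P : ProbabilityMeasure Z} :
    P ∈ deterministicLaws ι O μ ↔ ∃ (γ : ∀ n, I n → U n) (hγ : ∀ n, Measurable (γ n)),
      ∃ Q, IsLawUnder hι μ (fun n => Kernel.deterministic (γ n) (hγ n)) Q ∧
        (P : Measure Z) = Q.map O := by
  have hmap : ∀ γ : ∀ n, I n → U n, (∀ n, Measurable (γ n)) →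
      (μ.map fun ω => O (ω, closedLoopActions ι γ ω)) =
        (μ.map fun ω => (ω, closedLoopActions ι γ ω)).map O := fun γ hγ => by
    have hm : Measurable fun ω => (ω, closedLoopActions ι γ ω) :=
      measurable_id.prodMk (measurable_closedLoopActions hι hγ)
    rw [Measure.map_map hO hm]
    rfl
  constructor
  · rintro ⟨γ, hγ, hP⟩
    exact ⟨γ, hγ, _, isLawUnder_closedLoopActions hγ, by rw [hP, hmap γ hγ]⟩
  · rintro ⟨γ, hγ, Q, hQ, hP⟩
    refine ⟨γ, hγ, ?_⟩
    have hQ' := isLawUnder_closedLoopActions (hι := hι) (μ := μ) hγ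
    have := hQ.isProbabilityMeasure
    have := hQ'.isProbabilityMeasure
    rw [hP, hQ.unique hQ', hmap γ hγ]

variable {r : ∀ n, Z → I n × U n}

/-- The law of what `r n` reads off from the outcome. -/
noncomputable def readKernel (hr : ∀ n, Measurable (r n)) (n : Fin N) :
    Kernel (ProbabilityMeasure Z) (I n × U n) where
  toFun P := (P : Measure Z).map (r n)
  measurable' := (Measure.measurable_map _ (hr n)).comp measurable_subtype_coe

theorem readKernel_apply (hr : ∀ n, Measurable (r n)) (n : Fin N) (P : ProbabilityMeasure Z) :
    readKernel hr n P = (P : Measure Z).map (r n) := rfl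

instance (hr : ∀ n, Measurable (r n)) (n : Fin N) : IsMarkovKernel (readKernel hr n) :=
  ⟨fun P => by
    rw [readKernel_apply]; exact Measure.isProbabilityMeasure_map (hr n).aemeasurable⟩

variable [∀ n, StandardBorelSpace (U n)] [∀ n, Nonempty (U n)]

/-- A randomized policy whose actions are almost surely Dirac may be replaced by a deterministic
one. -/
theorem IsLawUnder.exists_deterministic {π : ∀ n, Kernel (I n) (U n)}
    [∀ n, IsMarkovKernel (π n)] {Q : Measure (Ω × (∀ n, U n))} (h : IsLawUnder hι μ π Q)
    (hd : ∀ n, ∀ᵐ i ∂(Q.map fun x => ι n (history n x)), ∃ u, π n i = Measure.dirac u) :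
    ∃ (γ : ∀ n, I n → U n) (hγ : ∀ n, Measurable (γ n)),
      IsLawUnder hι μ (fun n => Kernel.deterministic (γ n) (hγ n)) Q := by
  have := h.isProbabilityMeasure
  choose γ hγ hγπ using fun n => exists_ae_eq_deterministic _ (π n) (hd n)
  exact ⟨γ, hγ, h.congr hγπ⟩

variable [∀ n, MeasurableSpace.CountablyGenerated (I n)]

/-- The policies reconstructed from the law of the outcome reproduce any randomized closed loop
that has this law. -/
theorem IsLawUnder.reconstruct (hr : ∀ n, Measurable (r n)) (hO : Measurable O)
    (hrO : ∀ n x, r n (O x) = (ι n (history n x), x.2 n)) {π : ∀ n, Kernel (I n) (U n)}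
    [∀ n, IsMarkovKernel (π n)] {Q : Measure (Ω × (∀ n, U n))} (h : IsLawUnder hι μ π Q)
    {P : ProbabilityMeasure Z} (hP : (P : Measure Z) = Q.map O) (n : Fin N) :
    (readKernel hr n).fst P = Q.map (fun x => ι n (history n x)) ∧
      π n =ᵐ[Q.map fun x => ι n (history n x)] (readKernel hr n).condKernel.sectR P := by
  have := h.isProbabilityMeasure
  have hι' : Measurable fun x : Ω × (∀ k, U k) => ι n (history n x) :=
    (hι n).comp (measurable_history n)
  have hρ : readKernel hr n P = Q.map fun x => (ι n (history n x), x.2 n) := by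
    rw [readKernel_apply, hP, Measure.map_map (hr n) hO]
    congr 1
    funext x
    exact hrO n x
  have hfst : (readKernel hr n).fst P = Q.map (fun x => ι n (history n x)) := by
    have hm : Measurable fun x : Ω × (∀ k, U k) => (ι n (history n x), x.2 n) :=
      hι'.prodMk ((measurable_pi_apply n).comp measurable_snd)
    rw [Kernel.fst_apply, hρ, Measure.map_map measurable_fst hm]
    rfl
  refine ⟨hfst, ?_⟩
  -- `π n` and the conditional kernel disintegrate the same joint law, hence agree almost surely.
  have hd := congrArg (fun κ => κ P)
    (Kernel.disintegrate (readKernel hr n) (readKernel hr n).condKernel)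
  simp only [Kernel.compProd_apply_eq_compProd_sectR, hfst, hρ, h.map_info_action n] at hd
  have : IsProbabilityMeasure (Q.map fun x => ι n (history n x)) :=
    Measure.isProbabilityMeasure_map hι'.aemeasurable
  exact (Kernel.ae_eq_of_compProd_eq hd).symm

/-- The existential over policies is eliminated: the only candidate to test is the policy read off
from `P` itself. -/
theorem exists_kernel_mem_randomizedLaws_iff (hι : ∀ n, Measurable (ι n))
    (hr : ∀ n, Measurable (r n)) (hO : Measurable O)
    (hrO : ∀ n x, r n (O x) = (ι n (history n x), x.2 n)) :
    ∃ K : Kernel (ProbabilityMeasure Z) (Ω × (∀ n, U n)), IsMarkovKernel K ∧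
      (∀ P, IsLawUnder hι μ (fun n => (readKernel hr n).condKernel.sectR P) (K P)) ∧
      ∀ P, P ∈ randomizedLaws hι O μ ↔ (P : Measure Z) = (K P).map O := by
  obtain ⟨K, hK, hKP⟩ := exists_kernel_isLawUnder (ι := ι) hι μ
    fun n => (readKernel hr n).condKernel
  refine ⟨K, hK, hKP, fun P => ⟨?_, fun h => ⟨_, fun n => inferInstance, _, hKP P, h⟩⟩⟩
  rintro ⟨π, hπ, Q, hQ, hP⟩
  have := hQ.isProbabilityMeasure
  have hQ' := hQ.congr fun n => (hQ.reconstruct hr hO hrO hP n).2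
  rw [hP, hQ'.unique (hKP P)]

theorem measurableSet_randomizedLaws [MeasurableSpace.CountablyGenerated Z]
    (hι : ∀ n, Measurable (ι n)) (hr : ∀ n, Measurable (r n)) (hO : Measurable O)
    (hrO : ∀ n x, r n (O x) = (ι n (history n x), x.2 n)) :
    MeasurableSet (randomizedLaws hι O μ) := by
  obtain ⟨K, hK, -, h⟩ := exists_kernel_mem_randomizedLaws_iff (μ := μ) hι hr hO hrO
  have := Kernel.IsMarkovKernel.map K hO
  convert measurableSet_kernel_eq (evaluationKernel Z) (K.map O) using 1
  ext P
  rw [h P, Set.mem_ofPred_eq, Kernel.map_apply _ hO, evaluationKernel_apply]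

/-- Within the randomized laws, deterministic ones are singled out by the reconstructed kernels
being almost surely Dirac. -/
theorem measurableSet_deterministicLaws [MeasurableSpace.CountablyGenerated Z]
    (hι : ∀ n, Measurable (ι n)) (hr : ∀ n, Measurable (r n)) (hO : Measurable O)
    (hrO : ∀ n x, r n (O x) = (ι n (history n x), x.2 n)) :
    MeasurableSet (deterministicLaws ι O μ) := by
  let C := fun n => (readKernel hr n).condKernel
  -- The non-Dirac pairs form a jointly measurable set, so the mass of its section is measurable in
  -- `P`.
  let S : ∀ n, Set (ProbabilityMeasure Z × I n) := fun n =>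
    {p | (C n ×ₖ C n) p (Set.diagonal (U n))ᶜ ≠ 0}
  have hS : ∀ n, MeasurableSet (S n) := fun n =>
    (measurableSet_eq_fun (Kernel.measurable_coe _ measurableSet_diagonal.compl)
      measurable_const).compl
  have hSd : ∀ n P, {i | ¬ ∃ u, (C n).sectR P i = Measure.dirac u} = Prod.mk P ⁻¹' S n := by
    intro n P
    ext i
    simp only [Set.mem_ofPred_eq, exists_eq_dirac_iff, S, Set.mem_preimage, Kernel.prod_apply,
      Kernel.sectR_apply, ne_eq]
  have heq : deterministicLaws ι O μ = randomizedLaws hι O μ ∩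
      ⋂ n, {P | (readKernel hr n).fst P (Prod.mk P ⁻¹' S n) = 0} := by
    ext P
    have hae : ∀ n, (readKernel hr n).fst P (Prod.mk P ⁻¹' S n) = 0 ↔
        ∀ᵐ i ∂((readKernel hr n).fst P), ∃ u, (C n).sectR P i = Measure.dirac u := by
      intro n
      rw [ae_iff, hSd]
    simp only [Set.mem_inter_iff, Set.mem_iInter, Set.mem_ofPred_eq, hae]
    constructor
    · intro h
      obtain ⟨γ, hγ, Q, hQ, hP⟩ := (mem_deterministicLaws_iff (hι := hι) hO).mp h
      refine ⟨⟨_, fun n => inferInstance, Q, hQ, hP⟩, fun n => ?_⟩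
      obtain ⟨h1, h2⟩ := hQ.reconstruct hr hO hrO hP n
      rw [h1]
      filter_upwards [h2] with i hi
      exact ⟨γ n i, by rw [← hi, Kernel.deterministic_apply]⟩
    · rintro ⟨⟨π, hπ, Q, hQ, hP⟩, hd⟩
      have := hQ.isProbabilityMeasure
      obtain ⟨γ, hγ, hQγ⟩ := hQ.exists_deterministic fun n => by
        obtain ⟨h1, h2⟩ := hQ.reconstruct hr hO hrO hP n
        have := hd n
        rw [h1] at this
        filter_upwards [h2, this] with i hi hi'
        rwa [hi]
      exact (mem_deterministicLaws_iff (hι := hι) hO).mpr ⟨γ, hγ, Q, hQγ, hP⟩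
  rw [heq]
  refine (measurableSet_randomizedLaws hι hr hO hrO).inter (MeasurableSet.iInter fun n => ?_)
  exact measurableSet_eq_fun (Kernel.measurable_kernel_prodMk_left (hS n)) measurable_const

end StrategicMeasures

/-! ### Application to teams, and the intersection formula. -/

namespace SequentialTeam

variable {N : ℕ} {Ω Ω₀ : Type*} {Y U : Fin N → Type*}
  [MeasurableSpace Ω] [MeasurableSpace Ω₀]
  [∀ n, MeasurableSpace (Y n)] [∀ n, MeasurableSpace (U n)]

theorem randomizedStrategicMeasures_eq (T : SequentialTeam Ω Ω₀ Y U) (μ : Measure Ω) :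
    T.randomizedStrategicMeasures μ = randomizedLaws T.measurable_η T.outcome μ := by
  ext P
  constructor
  · rintro ⟨π, hπ, Q, ⟨h1, h2⟩, hP⟩
    exact ⟨π, hπ, Q, ⟨h1, h2⟩, hP⟩
  · rintro ⟨π, hπ, Q, ⟨h1, h2⟩, hP⟩
    exact ⟨π, hπ, Q, ⟨h1, h2⟩, hP⟩

/-- The measurement and the action of decision maker `n`. -/
def readMeasurement (n : Fin N) (z : Ω₀ × (∀ n, Y n × U n)) : Y n × U n := z.2 n

/-- The first `n` measurements and the action of decision maker `n`. -/
def readClassical (n : Fin N) (z : Ω₀ × (∀ n, Y n × U n)) : (∀ j : Set.Iic n, Y j) × U n :=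
  (fun j => (z.2 j).1, (z.2 n).2)

theorem measurable_readMeasurement (n : Fin N) :
    Measurable (readMeasurement (Ω₀ := Ω₀) (Y := Y) (U := U) n) :=
  (measurable_pi_apply n).comp measurable_snd

theorem measurable_readClassical (n : Fin N) :
    Measurable (readClassical (Ω₀ := Ω₀) (Y := Y) (U := U) n) :=
  (measurable_pi_lambda _ fun j : Set.Iic n =>
    measurable_fst.comp ((measurable_pi_apply (j : Fin N)).comp measurable_snd)).prodMk
    (measurable_snd.comp ((measurable_pi_apply n).comp measurable_snd))

theorem readMeasurement_outcome (T : SequentialTeam Ω Ω₀ Y U) (n : Fin N)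
    (x : Ω × (∀ n, U n)) :
    readMeasurement n (T.outcome x) = (T.η n (history n x), x.2 n) := rfl

theorem readClassical_outcome (T : SequentialTeam Ω Ω₀ Y U) (n : Fin N)
    (x : Ω × (∀ n, U n)) :
    readClassical n (T.outcome x) = (T.classicalInfo n (history n x), x.2 n) := rfl

theorem closedLoopActions_classicalInfo (T : SequentialTeam Ω Ω₀ Y U) (γ : ∀ n, Y n → U n)
    (ω : Ω) (n : Fin N) :
    closedLoopActions T.classicalInfo (fun n y => γ n (y ⟨n, Set.mem_Iic.mpr le_rfl⟩)) ω n =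
      closedLoopActions T.η γ ω n := by
  induction n using WellFoundedLT.induction with
  | ind n ih =>
    rw [closedLoopActions, closedLoopActions]
    have : (fun k : Set.Iio n => closedLoopActions T.classicalInfo
        (fun n y => γ n (y ⟨n, Set.mem_Iic.mpr le_rfl⟩)) ω k.1) =
        fun k : Set.Iio n => closedLoopActions T.η γ ω k.1 := funext fun k => ih k.1 k.2
    rw [this]
    rfl

theorem deterministic_subset_classical (T : SequentialTeam Ω Ω₀ Y U) (μ : Measure Ω) :
    T.deterministicStrategicMeasures μ ⊆ T.classicalStrategicMeasures μ := by
  rintro P ⟨γ, hγ, hP⟩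
  refine ⟨fun n y => γ n (y ⟨n, Set.mem_Iic.mpr le_rfl⟩),
    fun n => (hγ n).comp (measurable_pi_apply _), ?_⟩
  rw [hP]
  congr 1
  funext ω
  rw [funext (T.closedLoopActions_classicalInfo γ ω)]

theorem deterministic_subset_randomized (T : SequentialTeam Ω Ω₀ Y U) (μ : Measure Ω)
    [IsProbabilityMeasure μ] :
    T.deterministicStrategicMeasures μ ⊆ T.randomizedStrategicMeasures μ := by
  rintro P hP
  obtain ⟨γ, hγ, Q, hQ, hPQ⟩ :=
    (mem_deterministicLaws_iff (hι := T.measurable_η) T.measurable_outcome).mp hP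
  exact ⟨_, fun n => inferInstance, Q, ⟨hQ.map_fst, hQ.map_action⟩, hPQ⟩

/-- A randomized policy that induces a law of a deterministic classical policy is essentially
deterministic. -/
theorem randomized_inter_classical_subset [∀ n, StandardBorelSpace (U n)] [∀ n, Nonempty (U n)]
    (T : SequentialTeam Ω Ω₀ Y U) (μ : Measure Ω) [IsProbabilityMeasure μ] :
    T.randomizedStrategicMeasures μ ∩ T.classicalStrategicMeasures μ ⊆
      T.deterministicStrategicMeasures μ := by
  rintro P ⟨hR, hC⟩
  rw [randomizedStrategicMeasures_eq] at hR
  obtain ⟨π, hπ, Q, hQ, hP⟩ := hR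
  obtain ⟨γ, hγ, hPγ⟩ := hC
  have := hQ.isProbabilityMeasure
  have hm : Measurable fun ω => T.outcome (ω, closedLoopActions T.classicalInfo γ ω) :=
    T.measurable_outcome.comp
      (measurable_id.prodMk (measurable_closedLoopActions T.measurable_classicalInfo hγ))
  have hd : ∀ n, ∀ᵐ i ∂(Q.map fun x => T.η n (history n x)), ∃ u, π n i = Measure.dirac u := by
    intro n
    have hgraph : MeasurableSet {z : Ω₀ × (∀ n, Y n × U n) |
        (readClassical n z).2 = γ n (readClassical n z).1} :=
      measurableSet_eq_fun (measurable_snd.comp (measurable_readClassical n))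
        ((hγ n).comp (measurable_fst.comp (measurable_readClassical n)))
    have h1 : ∀ᵐ z ∂(P : Measure (Ω₀ × (∀ n, Y n × U n))),
        (readClassical n z).2 = γ n (readClassical n z).1 := by
      rw [hPγ, ae_map_iff hm.aemeasurable hgraph]
      refine ae_of_all _ fun ω => ?_
      rw [readClassical_outcome]
      change closedLoopActions T.classicalInfo γ ω n = _
      rw [closedLoopActions]
      rfl
    rw [hP, ae_map_iff T.measurable_outcome.aemeasurable hgraph] at h1
    have hset : MeasurableSet {p : (Ω × PastActions U n) × U n |
        p.2 = γ n (T.classicalInfo n p.1)} :=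
      measurableSet_eq_fun measurable_snd
        ((hγ n).comp ((T.measurable_classicalInfo n).comp measurable_fst))
    have h2 : ∀ᵐ p ∂((Q.map (history n)) ⊗ₘ (π n).comap (T.η n) (T.measurable_η n)),
        p.2 = γ n (T.classicalInfo n p.1) := by
      rw [← hQ.map_action n, ae_map_iff (measurable_history_action n).aemeasurable hset]
      exact h1
    -- For almost every history, `π n` at the measurement is concentrated at one point, which may
    -- depend on the whole history.
    have h3 := Measure.ae_ae_of_ae_compProd h2
    -- Being Dirac depends on the measurement alone; measurability lets the statement pass from
    -- histories to measurements.
    have hdm : MeasurableSet {i : Y n | ∃ u, π n i = Measure.dirac u} := by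
      simp only [exists_eq_dirac_iff, ← Kernel.prod_apply]
      exact measurableSet_eq_fun (Kernel.measurable_coe _ measurableSet_diagonal.compl)
        measurable_const
    rw [show (fun x : Ω × (∀ k, U k) => T.η n (history n x)) = T.η n ∘ history n from rfl,
      ← Measure.map_map (T.measurable_η n) (measurable_history n),
      ae_map_iff (T.measurable_η n).aemeasurable hdm]
    filter_upwards [h3] with v hv
    rw [Kernel.comap_apply] at hv
    exact ⟨_, eq_dirac_of_ae_eq hv⟩
  obtain ⟨γ', hγ', hQ'⟩ := hQ.exists_deterministic hd
  exact (mem_deterministicLaws_iff (hι := T.measurable_η) T.measurable_outcome).mpr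
    ⟨γ', hγ', Q, hQ', hP⟩

end SequentialTeam
theorem mainTheorem6 {N : ℕ} {Ω Ω₀ : Type*} {Y U : Fin N → Type*}
    [MeasurableSpace Ω]
    [TopologicalSpace Ω₀] [TopologicalSpace.MetrizableSpace Ω₀] [SecondCountableTopology Ω₀]
    [MeasurableSpace Ω₀] [BorelSpace Ω₀] [StandardBorelSpace Ω₀]
    [∀ n, TopologicalSpace (Y n)] [∀ n, TopologicalSpace.MetrizableSpace (Y n)]
    [∀ n, SecondCountableTopology (Y n)]
    [∀ n, MeasurableSpace (Y n)] [∀ n, BorelSpace (Y n)] [∀ n, StandardBorelSpace (Y n)]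
    [∀ n, TopologicalSpace (U n)] [∀ n, TopologicalSpace.MetrizableSpace (U n)]
    [∀ n, SecondCountableTopology (U n)]
    [∀ n, MeasurableSpace (U n)] [∀ n, BorelSpace (U n)] [∀ n, StandardBorelSpace (U n)]
    (T : SequentialTeam Ω Ω₀ Y U) (μ : Measure Ω) [IsProbabilityMeasure μ] :
    MeasurableSet[borel (ProbabilityMeasure (Ω₀ × (∀ n, Y n × U n)))]
        (T.randomizedStrategicMeasures μ) ∧
      MeasurableSet[borel (ProbabilityMeasure (Ω₀ × (∀ n, Y n × U n)))]
        (T.deterministicStrategicMeasures μ) ∧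
      MeasurableSet[borel (ProbabilityMeasure (Ω₀ × (∀ n, Y n × U n)))]
        (T.classicalStrategicMeasures μ) ∧
      T.deterministicStrategicMeasures μ =
        T.randomizedStrategicMeasures μ ∩ T.classicalStrategicMeasures μ := by
  by_cases hU : ∀ n, Nonempty (U n)
  · have hle := measurableSpace_probabilityMeasure_le_borel (Z := Ω₀ × (∀ n, Y n × U n))
    refine ⟨hle _ ?_, hle _ ?_, hle _ ?_, ?_⟩
    · rw [T.randomizedStrategicMeasures_eq]
      exact measurableSet_randomizedLaws T.measurable_η
        SequentialTeam.measurable_readMeasurement T.measurable_outcome T.readMeasurement_outcome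
    · exact measurableSet_deterministicLaws T.measurable_η
        SequentialTeam.measurable_readMeasurement T.measurable_outcome T.readMeasurement_outcome
    · exact measurableSet_deterministicLaws T.measurable_classicalInfo
        SequentialTeam.measurable_readClassical T.measurable_outcome T.readClassical_outcome
    · exact Set.Subset.antisymm
        (Set.subset_inter (T.deterministic_subset_randomized μ)
          (T.deterministic_subset_classical μ))
        (T.randomized_inter_classical_subset μ)
  -- With an empty action space there are no laws at all, and all three sets are empty.
  · have hE : IsEmpty (ProbabilityMeasure (Ω₀ × (∀ n, Y n × U n))) := by
      refine ⟨fun P => hU fun n => ?_⟩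
      obtain ⟨z⟩ := P.nonempty
      exact ⟨(z.2 n).2⟩
    have h : ∀ s : Set (ProbabilityMeasure (Ω₀ × (∀ n, Y n × U n))), s = ∅ :=
      fun s => Set.eq_empty_of_isEmpty s
    rw [h (T.randomizedStrategicMeasures μ), h (T.deterministicStrategicMeasures μ),
      h (T.classicalStrategicMeasures μ)]
    simp
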